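/- Let $\psi=\Gamma'/\Gamma$ be the digamma function, $\gamma$ Euler's constant, $\zeta$ the Riemann zeta function, and let $\xi(s)=(s-1)\pi^{-s/2}\Gamma\left(1+\tfrac s2\right)\zeta(s)$ and $\Xi(t)=\xi\left(\tfrac12+it\right)$ be Riemann's functions. For $x>0$ put $$\tau(x)=\frac12\left(\psi\left(1+\frac x2\right)-\psi\left(\frac{1+x}2\right)\right)+\psi\left(x+\frac12\right)-\frac1{2x}-\log x .$$ Let $\alpha,\beta$ be positive real numbers with $\alpha\beta=1$. Then the series $\sum_{n\ge1}\tau(n\alpha)$ and $\sum_{n\ge1}\tau(n\beta)$ converge absolutely, the integral below converges absolutely, and $$\sqrt{\alpha}\left(\frac{\gamma-\log(\pi\alpha)}{2\alpha}+\sum_{n=1}^\infty\tau(n\alpha)\right)=\sqrt{\beta}\left(\frac{\gamma-\log(\pi\beta)}{2\beta}+\sum_{n=1}^\infty\tau(n\beta)\right)$$ $$=-\frac{2}{\pi^{3/2}}\int_0^\infty\left|\Gamma\left(\frac{-1+it}4\right)\right|^2\,\Xi^2\left(\frac t2\right)\,\frac{\cos\left(\frac12t\log\alpha\right)\left(\sqrt2\cos\left(\frac12t\log2\right)-1\right)}{1+t^2}\,dt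 .$$ -/

import Mathlib

open MeasureTheory Set

noncomputable section

namespace KoshliakovModular

/-- The digamma function `ψ(x) = Γ'(x) / Γ(x)` on the real line
(used below at positive arguments only). -/
def psi (x : ℝ) : ℝ := deriv Real.Gamma x / Real.Gamma x

/-- On the positive axis, `psi` agrees with Mathlib's complex digamma function. -/
theorem psi_eq_digamma {x : ℝ} (hx : 0 < x) : (psi x : ℂ) = Complex.digamma x := by
  have hd : DifferentiableAt ℂ Complex.Gamma (x : ℂ) := by
    refine Complex.differentiableAt_Gamma _ fun m h => ?_
    have h' : x = -(m : ℝ) := by exact_mod_cast h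
    have : (0 : ℝ) ≤ m := Nat.cast_nonneg m
    linarith
  have h1 : HasDerivAt (fun y : ℝ => ((Real.Gamma y : ℝ) : ℂ)) (deriv Complex.Gamma x) x := by
    simpa only [Complex.Gamma_ofReal] using hd.hasDerivAt.comp_ofReal
  have hr : DifferentiableAt ℝ Real.Gamma x := by
    refine Real.differentiableAt_Gamma fun m h => ?_
    have : (0 : ℝ) ≤ m := Nat.cast_nonneg m
    linarith
  have h2 : ((deriv Real.Gamma x : ℝ) : ℂ) = deriv Complex.Gamma x :=
    hr.hasDerivAt.ofReal_comp.unique h1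
  rw [psi, Complex.digamma_def, logDeriv_apply, Complex.Gamma_ofReal, ← h2]
  push_cast
  rfl

/-- `τ(x) = ½ (ψ(1 + x/2) - ψ((1 + x)/2)) + ψ(x + ½) - 1/(2x) - log x`, for `x > 0`. -/
def tau (x : ℝ) : ℝ :=
  (1 / 2) * (psi (1 + x / 2) - psi ((1 + x) / 2)) + psi (x + 1 / 2) - 1 / (2 * x) - Real.log x

/-- Riemann's function `ξ(s) = (s - 1) π^(-s/2) Γ(1 + s/2) ζ(s)`. The formula is literally
correct off the removable singularities `s = 1, -2, -4, …`, in particular on `Re s = 1/2`,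
the only place where it is used. -/
def xi (s : ℂ) : ℂ :=
  (s - 1) * (Real.pi : ℂ) ^ (-s / 2) * Complex.Gamma (1 + s / 2) * riemannZeta s

/-- Riemann's function `Ξ(t) = ξ(1/2 + i t)` of a real variable `t`. -/
def Xi (t : ℝ) : ℂ := xi (1 / 2 + Complex.I * t)

/-- `√α ((γ - log (π α)) / (2 α) + ∑_{n ≥ 1} τ(n α))`. -/
def modularSide (α : ℝ) : ℝ :=
  Real.sqrt α * ((Real.eulerMascheroniConstant - Real.log (Real.pi * α)) / (2 * α)
    + ∑' n : ℕ, tau (((n : ℝ) + 1) * α))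

/-- The integrand
`|Γ((-1 + i t)/4)|² Ξ(t/2)² cos(½ t log α) (√2 cos(½ t log 2) - 1) / (1 + t²)`. -/
def modularIntegrand (α t : ℝ) : ℂ :=
  ((‖Complex.Gamma ((-1 + Complex.I * t) / 4)‖ ^ 2 : ℝ) : ℂ) * Xi (t / 2) ^ 2 *
    ((Real.cos (1 / 2 * t * Real.log α) *
        (Real.sqrt 2 * Real.cos (1 / 2 * t * Real.log 2) - 1) / (1 + t ^ 2) : ℝ) : ℂ)

end KoshliakovModular

end

noncomputable section

namespace KoshliakovModular

open Real Filter Topology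
open scoped FourierTransform Convolution

/-! Let f(t) = 1/(e^t - 1) - 1/t (`bose`) and C(a) = √a ∫ f(t) f(at) dt over t > 0
(`boseCorrelation`). Both sides of the theorem come from evaluating C in two ways.

Series side. Put φ(x) = ψ(x) + 1/(2x) - log x. By Binet, -φ is the Laplace transform of f + 1/2, so
expanding 1/(e^{at} - 1) geometrically produces ∑ φ(na). What remains of f(t) f(at) is a kernel
whose integral, a limit of Mellin transforms, is elementary. Hence C(a) = -√a ((γ - log 2πa)/(2a) +
∑ φ(na)) (`integral_bose_mul_bose`). Duplication gives τ(x) = φ(x/2) - 2φ(x) + 2φ(2x), so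
`modularSide` is a combination of C(a/2), C(a) and C(2a) (`modularSide_eq_boseCorrelation`).

Integral side. The Mellin transform of f in the critical strip is Γ(s)ζ(s) (`mellin_bose`). With t =
e^{-u}, C becomes an additive autocorrelation, and Wiener-Khinchin writes it as a cosine integral
against |Γζ(1/2 + it/2)|² (`boseCorrelation_eq_integral`). The three cosines combine into cos(½ t
log a)(√2 cos(½ t log 2) - 1). Legendre duplication and the functional equation identify the weight
with |Γ((-1 + it)/4)|² Ξ²(t/2)/(1 + t²), up to a constant (`norm_Gamma_sq_mul_Xi_sq`). Since a
enters only through an even function of log a, the symmetry α ↔ 1/α is immediate. -/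

/-- The function `1 / (e^x - 1) - 1 / x`. -/
def bose (x : ℝ) : ℝ := (exp x - 1)⁻¹ - x⁻¹

/-! ### Elementary bounds for 1/(e^x - 1) - 1/x. -/

theorem exp_sub_one_pos {x : ℝ} (hx : 0 < x) : 0 < exp x - 1 := by
  linarith [add_one_lt_exp hx.ne']

theorem bose_nonpos {x : ℝ} (hx : 0 < x) : bose x ≤ 0 := by
  have h := add_one_le_exp x
  exact sub_nonpos.2 (inv_anti₀ hx (by linarith))

theorem neg_inv_le_bose {x : ℝ} (hx : 0 < x) : -x⁻¹ ≤ bose x := by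
  have := inv_pos.2 (exp_sub_one_pos hx)
  unfold bose
  linarith

theorem bose_add_half_nonneg {x : ℝ} (hx : 0 < x) : 0 ≤ bose x + 1 / 2 := by
  have h0 := exp_sub_one_pos hx
  have key : ∀ y : ℝ, 0 ≤ y → 0 ≤ (y - 2) * exp y + y + 2 := by
    intro y hy
    have hm : MonotoneOn (fun y : ℝ => (y - 2) * exp y + y + 2) (Ici 0) := by
      apply monotoneOn_of_deriv_nonneg (convex_Ici 0) (by fun_prop) (by fun_prop)
      intro z hz
      have hd : HasDerivAt (fun y : ℝ => (y - 2) * exp y + y + 2)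
          (1 * exp z + (z - 2) * exp z + 1) z :=
        ((((hasDerivAt_id z).sub_const 2).mul (Real.hasDerivAt_exp z)).add
          (hasDerivAt_id z)).add_const 2
      rw [hd.deriv]
      -- Multiplying e^{-z} ≥ 1 - z by e^z gives nonnegativity of the derivative (z - 1)e^z + 1.
      have h1 := add_one_le_exp (-z)
      have h2 : exp (-z) * exp z = 1 := by rw [← exp_add]; simp
      nlinarith [exp_pos z]
    have := hm (mem_Ici.2 le_rfl) (mem_Ici.2 hy) hy
    norm_num at this
    linarith
  have h := key x hx.le
  have : bose x + 1 / 2 = ((x - 2) * exp x + x + 2) / (2 * x * (exp x - 1)) := by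
    unfold bose
    field_simp
    ring
  rw [this]
  positivity

theorem quadratic_le_exp_sub_one {x : ℝ} (hx : 0 < x) : x + x ^ 2 / 2 ≤ exp x - 1 := by
  linarith [quadratic_le_exp_of_nonneg hx.le]

theorem bose_add_half_le {x : ℝ} (hx : 0 < x) : bose x + 1 / 2 ≤ x / 4 := by
  have h1 : (exp x - 1)⁻¹ ≤ (x + x ^ 2 / 2)⁻¹ :=
    inv_anti₀ (by positivity) (quadratic_le_exp_sub_one hx)
  have h2 : (x + x ^ 2 / 2)⁻¹ - x⁻¹ + 1 / 2 ≤ x / 4 := by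
    have : x / 4 - ((x + x ^ 2 / 2)⁻¹ - x⁻¹ + 1 / 2) = x ^ 2 / (4 * (x + 2)) := by
      field_simp
      ring
    have h3 : 0 ≤ x ^ 2 / (4 * (x + 2)) := by positivity
    linarith
  unfold bose
  linarith

theorem bose_add_half_le_half {x : ℝ} (hx : 0 < x) : bose x + 1 / 2 ≤ 1 / 2 := by
  linarith [bose_nonpos hx]

theorem continuousOn_bose : ContinuousOn bose (Ioi 0) := by
  unfold bose
  refine ContinuousOn.sub (ContinuousOn.inv₀ (by fun_prop) ?_) (ContinuousOn.inv₀ (by fun_prop) ?_)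
  · intro x hx
    exact (exp_sub_one_pos hx).ne'
  · intro x hx
    exact (mem_Ioi.1 hx).ne'

/-! ### Laplace integrals and Binet's formula for ψ. -/

theorem integrableOn_exp_neg_mul {a : ℝ} (ha : 0 < a) :
    IntegrableOn (fun t => exp (-(a * t))) (Ioi 0) := by
  simpa [neg_mul] using exp_neg_integrableOn_Ioi 0 ha

theorem integral_exp_neg_mul {a : ℝ} (ha : 0 < a) :
    ∫ t in Ioi 0, exp (-(a * t)) = 1 / a := by
  have := integral_exp_mul_Ioi (neg_lt_zero.2 ha) 0
  simp only [neg_mul] at this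
  rw [this]
  simp

theorem integrableOn_mul_exp_neg_mul {a : ℝ} (ha : 0 < a) :
    IntegrableOn (fun t => t * exp (-(a * t))) (Ioi 0) := by
  have := integrableOn_rpow_mul_exp_neg_mul_rpow (s := 1) (p := 1) (by norm_num) one_pos ha
  simpa [neg_mul] using this

theorem integral_mul_exp_neg_mul {a : ℝ} (ha : 0 < a) :
    ∫ t in Ioi 0, t * exp (-(a * t)) = 1 / a ^ 2 := by
  have := integral_rpow_mul_exp_neg_mul_Ioi (a := 2) two_pos ha
  norm_num at this
  rw [this]
  simp

theorem integrableOn_frullani_exp {x : ℝ} (hx : 0 < x) :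
    IntegrableOn (fun t => t⁻¹ * (exp (-(x * t)) - exp (-((x + 1) * t)))) (Ioi 0) := by
  refine Integrable.mono' (integrableOn_exp_neg_mul hx) ?_ ?_
  · refine ContinuousOn.aestronglyMeasurable ?_ measurableSet_Ioi
    refine ContinuousOn.mul (ContinuousOn.inv₀ (by fun_prop) ?_) (by fun_prop)
    intro t ht
    exact (mem_Ioi.1 ht).ne'
  · refine (ae_restrict_iff' measurableSet_Ioi).2 (Eventually.of_forall fun t ht => ?_)
    have ht : 0 < t := ht
    have h1 : exp (-((x + 1) * t)) = exp (-(x * t)) * exp (-t) := by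
      rw [← exp_add]; ring_nf
    have h2 := add_one_le_exp (-t)
    have h3 : exp (-t) ≤ 1 := by simpa using ht.le
    have h4 : t⁻¹ * (exp (-(x * t)) - exp (-((x + 1) * t))) =
        exp (-(x * t)) * (t⁻¹ * (1 - exp (-t))) := by rw [h1]; ring
    have h5 : t⁻¹ * (1 - exp (-t)) ≤ 1 := by
      rw [inv_mul_le_iff₀ ht]; linarith
    have h6 : 0 ≤ t⁻¹ * (1 - exp (-t)) := mul_nonneg (inv_nonneg.2 ht.le) (by linarith)
    rw [h4, norm_of_nonneg (mul_nonneg (exp_pos _).le h6)]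
    exact mul_le_of_le_one_right (exp_pos _).le h5

theorem integral_frullani_exp {x : ℝ} (hx : 0 < x) :
    ∫ t in Ioi 0, t⁻¹ * (exp (-(x * t)) - exp (-((x + 1) * t))) = log ((x + 1) / x) := by
  have h := Frullani.integral_Ioi_eq (f := fun t : ℝ => exp (-t)) (a := x) (b := x + 1)
    (L := 1) (R := 0)
    ((by fun_prop : Continuous fun t : ℝ => exp (-t)).locallyIntegrable.locallyIntegrableOn _)
    hx (by linarith) ?_ ?_ ?_
  · simpa using h
  · refine Tendsto.mono_left ?_ nhdsWithin_le_nhds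
    have : Continuous fun t : ℝ => exp (-t) := by fun_prop
    simpa using this.tendsto 0
  · exact tendsto_exp_neg_atTop_nhds_zero
  · simpa using integrableOn_frullani_exp hx

/-- The Laplace transform of `1 / (e^t - 1) - 1 / t + 1 / 2`. -/
def binetIntegral (x : ℝ) : ℝ := ∫ t in Ioi 0, (bose t + 1 / 2) * exp (-(x * t))

theorem continuousOn_bose_add_half_mul_exp (x : ℝ) :
    ContinuousOn (fun t => (bose t + 1 / 2) * exp (-(x * t))) (Ioi 0) :=
  (continuousOn_bose.add continuousOn_const).mul (by fun_prop)

theorem integrableOn_binet {x : ℝ} (hx : 0 < x) :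
    IntegrableOn (fun t => (bose t + 1 / 2) * exp (-(x * t))) (Ioi 0) := by
  refine Integrable.mono' (integrableOn_exp_neg_mul hx)
    ((continuousOn_bose_add_half_mul_exp x).aestronglyMeasurable measurableSet_Ioi)
    ((ae_restrict_iff' measurableSet_Ioi).2 (Eventually.of_forall fun t ht => ?_))
  rw [norm_of_nonneg (mul_nonneg (bose_add_half_nonneg ht) (exp_pos _).le)]
  exact mul_le_of_le_one_left (exp_pos _).le (by linarith [bose_add_half_le_half ht])

theorem binetIntegral_nonneg (x : ℝ) : 0 ≤ binetIntegral x :=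
  setIntegral_nonneg measurableSet_Ioi fun _ ht =>
    mul_nonneg (bose_add_half_nonneg ht) (exp_pos _).le

theorem binetIntegral_le {x : ℝ} (hx : 0 < x) : binetIntegral x ≤ 1 / (4 * x ^ 2) := by
  have h : binetIntegral x ≤ ∫ t in Ioi 0, 1 / 4 * (t * exp (-(x * t))) := by
    refine setIntegral_mono_on (integrableOn_binet hx)
      ((integrableOn_mul_exp_neg_mul hx).const_mul _) measurableSet_Ioi fun t ht => ?_
    have := mul_le_mul_of_nonneg_right (bose_add_half_le ht) (exp_pos (-(x * t))).le
    linarith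
  rw [integral_const_mul, integral_mul_exp_neg_mul hx] at h
  refine h.trans (le_of_eq ?_)
  field_simp

theorem binetIntegral_le_inv {x : ℝ} (hx : 0 < x) : binetIntegral x ≤ 1 / 2 * (1 / x) := by
  rw [← integral_exp_neg_mul hx, ← integral_const_mul]
  exact setIntegral_mono_on (integrableOn_binet hx) ((integrableOn_exp_neg_mul hx).const_mul _)
    measurableSet_Ioi fun t ht =>
      mul_le_mul_of_nonneg_right (bose_add_half_le_half ht) (exp_pos _).le

/-- The difference brings in the factor 1 - e^{-t}, which clears the denominator e^t - 1 of `bose`.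
Only pure exponentials and a Frullani integrand survive. -/
theorem binetIntegral_sub_add_one {x : ℝ} (hx : 0 < x) :
    binetIntegral x - binetIntegral (x + 1) =
      1 / 2 * (1 / x + 1 / (x + 1)) - log ((x + 1) / x) := by
  have hx1 : 0 < x + 1 := by linarith
  have e1 := integrableOn_exp_neg_mul hx
  have e2 := integrableOn_exp_neg_mul hx1
  rw [binetIntegral, binetIntegral, ← integral_sub (integrableOn_binet hx) (integrableOn_binet hx1),
    ← integral_frullani_exp hx, ← integral_exp_neg_mul hx, ← integral_exp_neg_mul hx1,
    ← integral_add e1 e2, ← integral_const_mul,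
    ← integral_sub (by exact (e1.add e2).const_mul _) (integrableOn_frullani_exp hx)]
  refine setIntegral_congr_fun measurableSet_Ioi fun t ht => ?_
  have h0 := exp_sub_one_pos ht
  have h1 : exp (-(x * t)) = exp (-((x + 1) * t)) * exp t := by
    rw [← exp_add]; ring_nf
  simp only [h1, bose]
  field_simp
  ring

theorem psi_add_one {x : ℝ} (hx : 0 < x) : psi (x + 1) = psi x + 1 / x := by
  have h := Complex.digamma_apply_add_one (x : ℂ) fun m h => by
    have h' : x = -(m : ℝ) := by exact_mod_cast h
    have : (0 : ℝ) ≤ m := Nat.cast_nonneg m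
    linarith
  rw [← psi_eq_digamma hx, show (x : ℂ) + 1 = ((x + 1 : ℝ) : ℂ) by push_cast; rfl,
    ← psi_eq_digamma (by linarith)] at h
  rw [one_div]
  exact_mod_cast h

theorem differentiableAt_Gamma_of_pos {x : ℝ} (hx : 0 < x) : DifferentiableAt ℝ Gamma x :=
  differentiableOn_Gamma_Ioi.differentiableAt (Ioi_mem_nhds hx)

theorem hasDerivAt_log_Gamma {x : ℝ} (hx : 0 < x) : HasDerivAt (log ∘ Gamma) (psi x) x :=
  (differentiableAt_Gamma_of_pos hx).hasDerivAt.log (Gamma_pos_of_pos hx).ne'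

theorem log_Gamma_add_one {x : ℝ} (hx : 0 < x) :
    log (Gamma (x + 1)) - log (Gamma x) = log x := by
  rw [Gamma_add_one hx.ne', log_mul hx.ne' (Gamma_pos_of_pos hx).ne']
  ring

/-- By convexity of log Γ, its slope log x over [x, x + 1] lies between the derivatives at the two
ends. -/
theorem psi_le_log {x : ℝ} (hx : 0 < x) : psi x ≤ log x := by
  have h := convexOn_log_Gamma.le_slope_of_hasDerivAt (mem_Ioi.2 hx)
    (mem_Ioi.2 (by linarith : 0 < x + 1)) (by linarith) (hasDerivAt_log_Gamma hx)
  simpa [slope_def_field, log_Gamma_add_one hx] using h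

theorem log_le_psi_add_one {x : ℝ} (hx : 0 < x) : log x ≤ psi (x + 1) := by
  have hx1 : 0 < x + 1 := by linarith
  have h := convexOn_log_Gamma.slope_le_of_hasDerivAt (mem_Ioi.2 hx)
    (mem_Ioi.2 hx1) (by linarith) (hasDerivAt_log_Gamma hx1)
  simpa [slope_def_field, log_Gamma_add_one hx] using h

/-- The value at x recurs at x + n, where the bound tends to 0. This is the uniqueness principle
that upgrades a difference equation to Binet's formula. -/
theorem eq_zero_of_periodic_of_bound {D : ℝ → ℝ} (hper : ∀ x, 0 < x → D (x + 1) = D x)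
    {C : ℝ} (hb : ∀ x, 0 < x → |D x| ≤ C / x) {x : ℝ} (hx : 0 < x) : D x = 0 := by
  have h1 : ∀ n : ℕ, D (x + n) = D x := by
    intro n
    induction n with
    | zero => simp
    | succ n ih =>
      rw [← ih, ← hper (x + n) (by positivity)]
      push_cast
      ring_nf
  have h2 : Tendsto (fun n : ℕ => C / (x + n)) atTop (𝓝 0) :=
    tendsto_const_nhds.div_atTop (tendsto_atTop_add_const_left _ _ tendsto_natCast_atTop_atTop)
  have h3 : |D x| ≤ 0 := ge_of_tendsto' h2 fun n => by
    have := hb (x + n) (by positivity)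
    rwa [h1] at this
  exact abs_nonpos_iff.1 h3

/-- Binet's formula for the digamma function. -/
theorem psi_add_inv_sub_log {x : ℝ} (hx : 0 < x) :
    psi x + 1 / (2 * x) - log x = -binetIntegral x := by
  have := eq_zero_of_periodic_of_bound
    (D := fun x => psi x + 1 / (2 * x) - log x + binetIntegral x) (C := 1) ?_ ?_ hx
  · linarith
  · intro y hy
    have hy1 : 0 < y + 1 := by linarith
    have h1 := binetIntegral_sub_add_one hy
    rw [log_div hy1.ne' hy.ne'] at h1
    have h2 := psi_add_one hy
    have h3 : 1 / (2 * y) = 1 / 2 * (1 / y) := by field_simp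
    have h4 : 1 / (2 * (y + 1)) = 1 / 2 * (1 / (y + 1)) := by field_simp
    simp only [h2, h3, h4]
    linarith
  · intro y hy
    have h1 := psi_le_log hy
    have h2 := log_le_psi_add_one hy
    rw [psi_add_one hy] at h2
    have h3 := binetIntegral_nonneg y
    have h4 := binetIntegral_le_inv hy
    have h5 : 1 / (2 * y) = 1 / 2 * (1 / y) := by field_simp
    have h6 : 0 < 1 / y := by positivity
    simp only [h5]
    rw [abs_le]
    constructor <;> linarith

/-! ### Mellin transforms of 1/(e^t - 1) and of `bose`. -/

theorem inv_exp_sub_one_le_inv {x : ℝ} (hx : 0 < x) : (exp x - 1)⁻¹ ≤ x⁻¹ :=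
  sub_nonpos.1 (bose_nonpos hx)

theorem inv_exp_sub_one_le_sq {x : ℝ} (hx : 0 < x) : (exp x - 1)⁻¹ ≤ 2 * (x ^ 2)⁻¹ := by
  have h := inv_anti₀ (by positivity : 0 < x ^ 2 / 2)
    ((by linarith : x ^ 2 / 2 ≤ x + x ^ 2 / 2).trans (quadratic_le_exp_sub_one hx))
  refine h.trans (le_of_eq ?_)
  field_simp

theorem continuousOn_inv_exp_sub_one : ContinuousOn (fun x : ℝ => (exp x - 1)⁻¹) (Ioi 0) :=
  ContinuousOn.inv₀ (by fun_prop) fun _ hx => (exp_sub_one_pos hx).ne'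

theorem locallyIntegrableOn_ofReal_of_continuousOn {f : ℝ → ℝ} (hf : ContinuousOn f (Ioi 0)) :
    LocallyIntegrableOn (fun t => (f t : ℂ)) (Ioi 0) :=
  (Complex.continuous_ofReal.comp_continuousOn hf).locallyIntegrableOn measurableSet_Ioi

theorem isBigO_ofReal_atTop {f : ℝ → ℂ} {C a : ℝ} (h : ∀ t, 1 < t → ‖f t‖ ≤ C * t ^ (-a)) :
    f =O[atTop] fun t : ℝ => t ^ (-a) := by
  refine Asymptotics.IsBigO.of_bound C ?_
  filter_upwards [eventually_gt_atTop 1] with t ht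
  rw [norm_of_nonneg (rpow_nonneg (by linarith) _)]
  exact h t ht

theorem isBigO_ofReal_nhdsGT_zero {f : ℝ → ℂ} {C b : ℝ}
    (h : ∀ t, 0 < t → t < 1 → ‖f t‖ ≤ C * t ^ (-b)) :
    f =O[𝓝[>] 0] fun t : ℝ => t ^ (-b) := by
  refine Asymptotics.IsBigO.of_bound C ?_
  filter_upwards [Ioo_mem_nhdsGT one_pos] with t ht
  rw [norm_of_nonneg (rpow_nonneg ht.1.le _)]
  exact h t ht.1 ht.2

theorem norm_inv_exp_sub_one_le {t : ℝ} (ht : 0 < t) :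
    ‖(((exp t - 1)⁻¹ : ℝ) : ℂ)‖ ≤ 2 * t ^ (-2 : ℝ) := by
  rw [Complex.norm_real, norm_of_nonneg (inv_nonneg.2 (exp_sub_one_pos ht).le), rpow_neg ht.le]
  exact_mod_cast inv_exp_sub_one_le_sq ht

theorem mellinConvergent_inv_exp_sub_one {s : ℂ} (h1 : 1 < s.re) (h2 : s.re < 2) :
    MellinConvergent (fun t => (((exp t - 1)⁻¹ : ℝ) : ℂ)) s := by
  refine mellinConvergent_of_isBigO_rpow (a := 2) (b := 1)
    (locallyIntegrableOn_ofReal_of_continuousOn continuousOn_inv_exp_sub_one)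
    (isBigO_ofReal_atTop (C := 2) fun t ht => norm_inv_exp_sub_one_le (by linarith)) h2
    (isBigO_ofReal_nhdsGT_zero (C := 1) fun t ht _ => ?_) h1
  rw [Complex.norm_real, norm_of_nonneg (inv_nonneg.2 (exp_sub_one_pos ht).le), rpow_neg_one,
    one_mul]
  exact inv_exp_sub_one_le_inv ht

theorem hasSum_exp_neg_succ_mul {t : ℝ} (ht : 0 < t) :
    HasSum (fun n : ℕ => exp (-((n + 1) * t))) (exp t - 1)⁻¹ := by
  have h := (hasSum_geometric_of_lt_one (exp_pos (-t)).le (by simpa using ht)).mul_left (exp (-t))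
  have h0 := exp_sub_one_pos ht
  convert! h using 1
  · funext n
    rw [← exp_nat_mul, ← exp_add]
    ring_nf
  · rw [exp_neg]
    field_simp

theorem mellin_inv_exp_sub_one {s : ℂ} (hs : 1 < s.re) :
    mellin (fun t => (((exp t - 1)⁻¹ : ℝ) : ℂ)) s = Complex.Gamma s * riemannZeta s := by
  have h := hasSum_mellin (ι := ℕ) (a := fun _ => 1) (p := fun n => (n : ℝ) + 1)
    (F := fun t => (((exp t - 1)⁻¹ : ℝ) : ℂ)) (s := s) (fun n => Or.inr (by positivity))
    (by linarith) (fun t ht => ?_) ?_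
  · rw [← h.tsum_eq, zeta_eq_tsum_one_div_nat_add_one_cpow hs, ← tsum_mul_left]
    refine tsum_congr fun n => ?_
    push_cast
    ring
  · have := (hasSum_exp_neg_succ_mul ht).map Complex.ofRealHom Complex.continuous_ofReal
    simpa [Function.comp_def, -neg_add_rev] using this
  · have := (summable_nat_add_iff 1).2 (Real.summable_one_div_nat_rpow.2 hs)
    simpa using this

/-- `1 / (e^t - 1)` with the singular part `1 / t` removed on `(0, 1]`. -/
def truncatedBose (t : ℝ) : ℂ :=
  (((exp t - 1)⁻¹ : ℝ) : ℂ) - (Ioc 0 1).indicator (fun t : ℝ => (t : ℂ) ^ (-1 : ℂ)) t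

theorem norm_bose_le_half {t : ℝ} (ht : 0 < t) : ‖(bose t : ℂ)‖ ≤ 1 / 2 := by
  rw [Complex.norm_real, Real.norm_eq_abs, abs_le]
  constructor <;> linarith [bose_nonpos ht, bose_add_half_nonneg ht]

theorem norm_bose_le_inv {t : ℝ} (ht : 0 < t) : ‖(bose t : ℂ)‖ ≤ t⁻¹ := by
  rw [Complex.norm_real, Real.norm_eq_abs, abs_le]
  constructor <;> linarith [bose_nonpos ht, neg_inv_le_bose ht, inv_pos.2 ht]

/-- Boundedness near 0, once 1/t is removed there, widens the strip from 1 < Re s < 2 to 0 < Re s <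
2. -/
theorem differentiableAt_mellin_truncatedBose {s : ℂ} (h0 : 0 < s.re) (h2 : s.re < 2) :
    MellinConvergent truncatedBose s ∧ DifferentiableAt ℂ (mellin truncatedBose) s := by
  have hloc : LocallyIntegrableOn truncatedBose (Ioi 0) := by
    refine (locallyIntegrableOn_ofReal_of_continuousOn continuousOn_inv_exp_sub_one).sub ?_
    have hpow : LocallyIntegrableOn (fun t : ℝ => (t : ℂ) ^ (-1 : ℂ)) (Ioi 0) :=
      ContinuousOn.locallyIntegrableOn (fun t ht => (Complex.continuousAt_ofReal_cpow_const t (-1)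
        (Or.inr (mem_Ioi.1 ht).ne')).continuousWithinAt) measurableSet_Ioi
    intro x hx
    obtain ⟨u, hu, hint⟩ := hpow x hx
    exact ⟨u, hu, Integrable.indicator hint measurableSet_Ioc⟩
  have htop : truncatedBose =O[atTop] fun t : ℝ => t ^ (-2 : ℝ) := by
    refine isBigO_ofReal_atTop (C := 2) fun t ht => ?_
    rw [truncatedBose, indicator_of_notMem (by simp [ht]), sub_zero]
    exact norm_inv_exp_sub_one_le (by linarith)
  have hzero : truncatedBose =O[𝓝[>] 0] fun t : ℝ => t ^ (-0 : ℝ) := by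
    refine isBigO_ofReal_nhdsGT_zero (C := 1 / 2) fun t ht ht1 => ?_
    rw [truncatedBose, indicator_of_mem (by exact ⟨ht, ht1.le⟩)]
    have := norm_bose_le_half ht
    simpa [bose, Complex.cpow_neg_one] using this
  exact ⟨mellinConvergent_of_isBigO_rpow hloc htop h2 hzero h0,
    mellin_differentiableAt_of_isBigO_rpow hloc htop h2 hzero h0⟩

theorem mellin_truncatedBose_of_one_lt {s : ℂ} (h1 : 1 < s.re) (h2 : s.re < 2) :
    mellin truncatedBose s = Complex.Gamma s * riemannZeta s - 1 / (s - 1) := by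
  have hi := hasMellin_cpow_Ioc (-1) (s := s) (by simpa using h1)
  have h := hasMellin_sub (mellinConvergent_inv_exp_sub_one h1 h2) hi.1
  rw [← mellin_inv_exp_sub_one h1, sub_eq_add_neg s 1, ← hi.2]
  exact h.2

/-- Analytic continuation from 1 < Re s < 2. The factor s - 1 keeps both sides analytic at s = 1. -/
theorem mellin_truncatedBose {s : ℂ} (h0 : 0 < s.re) (h2 : s.re < 2) :
    (s - 1) * mellin truncatedBose s + 1 = Complex.Gamma s * riemannZeta₁ s := by
  set U : Set ℂ := Complex.re ⁻¹' Ioo 0 2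
  have hU : IsOpen U := isOpen_Ioo.preimage Complex.continuous_re
  have hconv : Convex ℝ U := (convex_Ioo 0 2).linear_preimage Complex.reLm
  have hf : DifferentiableOn ℂ (fun s => (s - 1) * mellin truncatedBose s + 1) U := fun z hz =>
    ((((differentiableAt_id.sub_const 1).mul
      (differentiableAt_mellin_truncatedBose hz.1 hz.2).2).add_const 1).differentiableWithinAt)
  have hg : DifferentiableOn ℂ (fun s => Complex.Gamma s * riemannZeta₁ s) U := fun z hz => by
    refine (DifferentiableAt.mul (Complex.differentiableAt_Gamma z fun m hm => ?_)
      differentiable_riemannZeta₁.differentiableAt).differentiableWithinAt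
    have := hz.1
    rw [hm] at this
    simp at this
    linarith [(Nat.cast_nonneg m : (0 : ℝ) ≤ m)]
  refine AnalyticOnNhd.eqOn_of_preconnected_of_eventuallyEq (hf.analyticOnNhd hU)
    (hg.analyticOnNhd hU) hconv.isPreconnected (z₀ := 3 / 2) (by norm_num [U]) ?_ ⟨h0, h2⟩
  have hV : IsOpen (Complex.re ⁻¹' Ioo (1 : ℝ) 2) := isOpen_Ioo.preimage Complex.continuous_re
  filter_upwards [hV.mem_nhds (by norm_num : (3 / 2 : ℂ) ∈ _)] with z hz
  have hz1 : z ≠ 1 := fun h => by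
    have := hz.1
    rw [h] at this
    simp at this
  have hz1' := sub_ne_zero.2 hz1
  rw [mellin_truncatedBose_of_one_lt hz.1 hz.2, riemannZeta_eq_inv_sub_mul hz1]
  field_simp
  ring

theorem mellinConvergent_bose {s : ℂ} (h0 : 0 < s.re) (h1 : s.re < 1) :
    MellinConvergent (fun t => (bose t : ℂ)) s := by
  refine mellinConvergent_of_isBigO_rpow (a := 1) (b := 0)
    (locallyIntegrableOn_ofReal_of_continuousOn continuousOn_bose)
    (isBigO_ofReal_atTop (C := 1) fun t ht => ?_) h1
    (isBigO_ofReal_nhdsGT_zero (C := 1 / 2) fun t ht _ => ?_) h0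
  · rw [rpow_neg_one, one_mul]
    exact norm_bose_le_inv (by linarith)
  · simpa using norm_bose_le_half ht

/-- The Mellin transform of `1 / (e^t - 1) - 1 / t` in the critical strip. -/
theorem mellin_bose {s : ℂ} (h0 : 0 < s.re) (h1 : s.re < 1) :
    mellin (fun t => (bose t : ℂ)) s = Complex.Gamma s * riemannZeta s := by
  have hs1 : s ≠ 1 := fun h => by simp [h] at h1
  have hs1' := sub_ne_zero.2 hs1
  have hT := (differentiableAt_mellin_truncatedBose h0 (by linarith)).1
  have he : ∀ t ∈ Ioi (0 : ℝ), (t : ℂ) ^ (s - 1) •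
      (Ioi 1).indicator (fun t : ℝ => (t : ℂ) ^ (-1 : ℂ)) t = (Ioi 1).indicator (fun t : ℝ => (t : ℂ) ^ (s - 2)) t := by
    intro t ht
    have ht0 : (t : ℂ) ≠ 0 := by exact_mod_cast (mem_Ioi.1 ht).ne'
    by_cases h : t ∈ Ioi 1
    · rw [indicator_of_mem h, indicator_of_mem h, smul_eq_mul, ← Complex.cpow_add _ _ ht0]
      ring_nf
    · rw [indicator_of_notMem h, indicator_of_notMem h, smul_zero]
  have hre : (s - 2).re < -1 := by simp; linarith
  have hi : MellinConvergent ((Ioi 1).indicator fun t : ℝ => (t : ℂ) ^ (-1 : ℂ)) s := by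
    refine IntegrableOn.congr_fun ?_ (fun t ht => (he t ht).symm) measurableSet_Ioi
    exact ((integrableOn_Ioi_cpow_of_lt hre one_pos).integrable_indicator
      measurableSet_Ioi).integrableOn
  -- For Re s < 1 the part of 1/t on (1, ∞) can be removed too; its transform cancels the polar term
  -- -1/(s - 1).
  have hm : mellin ((Ioi 1).indicator fun t : ℝ => (t : ℂ) ^ (-1 : ℂ)) s = -1 / (s - 1) := by
    rw [mellin, setIntegral_congr_fun measurableSet_Ioi he,
      setIntegral_indicator measurableSet_Ioi, Ioi_inter_Ioi, max_eq_right zero_le_one,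
      integral_Ioi_cpow_of_lt hre one_pos]
    simp
    ring_nf
  have hsub := (hasMellin_sub hT hi).2
  rw [hm] at hsub
  have hb : mellin (fun t => (bose t : ℂ)) s =
      mellin (fun t => truncatedBose t -
        (Ioi 1).indicator (fun t : ℝ => (t : ℂ) ^ (-1 : ℂ)) t) s := by
    refine setIntegral_congr_fun measurableSet_Ioi fun t ht => ?_
    congr 1
    by_cases h : t ≤ 1
    · have h1 : t ∈ Ioc (0 : ℝ) 1 := ⟨ht, h⟩
      have h2 : t ∉ Ioi (1 : ℝ) := by simpa using h
      simp [truncatedBose, h1, h2, bose, Complex.cpow_neg_one]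
    · have h1 : t ∉ Ioc (0 : ℝ) 1 := fun h' => h h'.2
      have h2 : t ∈ Ioi (1 : ℝ) := by simpa using h
      simp [truncatedBose, h1, h2, bose, Complex.cpow_neg_one]
  have key := mellin_truncatedBose h0 (by linarith)
  rw [hb, hsub, riemannZeta_eq_inv_sub_mul hs1]
  field_simp
  linear_combination key

/-! ### The constant term (γ - log 2πa)/2. -/

/-- The kernel `(1 / (e^t - 1) - 1 / t) / t + (a / 2) / (e^(a t) - 1)`, whose integral gives the
constant term in Ramanujan's transformation. -/
def constKernel (a t : ℝ) : ℝ := t⁻¹ * bose t + a / 2 * (exp (a * t) - 1)⁻¹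

theorem continuousOn_constKernel {a : ℝ} (ha : 0 < a) :
    ContinuousOn (constKernel a) (Ioi 0) := by
  refine ((continuousOn_inv₀.mono fun t ht => (mem_Ioi.1 ht).ne').mul continuousOn_bose).add
    (continuousOn_const.mul (continuousOn_inv_exp_sub_one.comp (by fun_prop) fun t ht => ?_))
  exact mul_pos ha ht

/-- The coefficient a/2 is chosen so that the singularities -1/(2t) and 1/(2t) at 0 cancel. -/
theorem norm_constKernel_le_const {a : ℝ} (ha : 0 < a) {t : ℝ} (ht : 0 < t) :
    ‖(constKernel a t : ℂ)‖ ≤ 1 / 4 + a / 4 := by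
  have hat := mul_pos ha ht
  have h : constKernel a t = t⁻¹ * (bose t + 1 / 2) + a / 2 * (bose (a * t) + 1 / 2) - a / 4 := by
    unfold constKernel bose
    field_simp
    ring
  have h1 : t⁻¹ * (bose t + 1 / 2) ≤ 1 / 4 := by
    rw [inv_mul_le_iff₀ ht]
    linarith [bose_add_half_le ht]
  have h2 : 0 ≤ t⁻¹ * (bose t + 1 / 2) := mul_nonneg (inv_pos.2 ht).le (bose_add_half_nonneg ht)
  have h3 : 0 ≤ a / 2 * (bose (a * t) + 1 / 2) :=
    mul_nonneg (by positivity) (bose_add_half_nonneg hat)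
  have h4 : a / 2 * (bose (a * t) + 1 / 2) ≤ a / 2 * (1 / 2) :=
    mul_le_mul_of_nonneg_left (bose_add_half_le_half hat) (by positivity)
  rw [Complex.norm_real, Real.norm_eq_abs, abs_le, h]
  constructor <;> linarith

theorem norm_constKernel_le_sq {a : ℝ} (ha : 0 < a) {t : ℝ} (ht : 0 < t) :
    ‖(constKernel a t : ℂ)‖ ≤ (1 + a⁻¹) * t ^ (-2 : ℝ) := by
  have hat := mul_pos ha ht
  have ht2 : t ^ (-2 : ℝ) = t⁻¹ * t⁻¹ := by
    rw [rpow_neg ht.le, ← mul_inv, ← sq]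
    norm_cast
  have ht' := inv_pos.2 ht
  have h1 : t⁻¹ * bose t ≤ 0 := mul_nonpos_of_nonneg_of_nonpos ht'.le (bose_nonpos ht)
  have h2 : t⁻¹ * (-t⁻¹) ≤ t⁻¹ * bose t := mul_le_mul_of_nonneg_left (neg_inv_le_bose ht) ht'.le
  have h3 : 0 ≤ a / 2 * (exp (a * t) - 1)⁻¹ :=
    mul_nonneg (by positivity) (inv_pos.2 (exp_sub_one_pos hat)).le
  have h4 : a / 2 * (exp (a * t) - 1)⁻¹ ≤ a / 2 * (2 * ((a * t) ^ 2)⁻¹) :=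
    mul_le_mul_of_nonneg_left (inv_exp_sub_one_le_sq hat) (by positivity)
  have h5 : a / 2 * (2 * ((a * t) ^ 2)⁻¹) = a⁻¹ * (t⁻¹ * t⁻¹) := by
    field_simp
  have h6 : 0 < a⁻¹ * (t⁻¹ * t⁻¹) := by positivity
  have h7 : 0 < t⁻¹ * t⁻¹ := by positivity
  rw [Complex.norm_real, Real.norm_eq_abs, abs_le, ht2, constKernel]
  constructor <;> nlinarith

theorem mellin_constKernel_regular {a : ℝ} (ha : 0 < a) {s : ℂ} (h0 : 0 < s.re) (h2 : s.re < 2) :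
    MellinConvergent (fun t => (constKernel a t : ℂ)) s ∧
      DifferentiableAt ℂ (mellin fun t => (constKernel a t : ℂ)) s := by
  have hloc := locallyIntegrableOn_ofReal_of_continuousOn (continuousOn_constKernel ha)
  have htop := isBigO_ofReal_atTop (f := fun t => (constKernel a t : ℂ)) (C := 1 + a⁻¹) (a := 2)
    fun t ht => norm_constKernel_le_sq ha (by linarith)
  have hzero := isBigO_ofReal_nhdsGT_zero (f := fun t => (constKernel a t : ℂ))
    (C := 1 / 4 + a / 4) (b := 0)
    fun t ht _ => by simpa using norm_constKernel_le_const ha ht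
  exact ⟨mellinConvergent_of_isBigO_rpow hloc htop h2 hzero h0,
    mellin_differentiableAt_of_isBigO_rpow hloc htop h2 hzero h0⟩

theorem mellin_constKernel_add_one {a : ℝ} (ha : 0 < a) {s : ℂ} (h0 : 0 < s.re) (h1 : s.re < 1) :
    mellin (fun t => (constKernel a t : ℂ)) (s + 1) =
      Complex.Gamma s * riemannZeta s +
        (a : ℂ) / 2 * ((a : ℂ) ^ (-(s + 1)) * (Complex.Gamma (s + 1) * riemannZeta (s + 1))) := by
  have hs : 1 < (s + 1).re ∧ (s + 1).re < 2 := by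
    constructor <;> simp <;> linarith
  have c1 : MellinConvergent (fun t : ℝ => (t : ℂ) ^ (-1 : ℂ) • (bose t : ℂ)) (s + 1) :=
    MellinConvergent.cpow_smul.2 (by simpa using mellinConvergent_bose h0 h1)
  have c2 : MellinConvergent (fun t : ℝ => (((exp (a * t) - 1)⁻¹ : ℝ) : ℂ)) (s + 1) :=
    (MellinConvergent.comp_mul_left (f := fun t : ℝ => (((exp t - 1)⁻¹ : ℝ) : ℂ)) ha).2
      (mellinConvergent_inv_exp_sub_one hs.1 hs.2)
  have h := (hasMellin_add c1 (c2.const_smul ((a : ℂ) / 2))).2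
  rw [mellin_cpow_smul, mellin_const_smul,
    mellin_comp_mul_left (fun t : ℝ => (((exp t - 1)⁻¹ : ℝ) : ℂ)) _ ha,
    mellin_inv_exp_sub_one hs.1, add_neg_cancel_right, mellin_bose h0 h1] at h
  simp only [smul_eq_mul] at h
  rw [← h]
  congr 1
  funext t
  simp [constKernel, Complex.cpow_neg_one]

/-- The two pieces of the kernel diverge separately at 1, but the whole transform is continuous
there, so its value is the limit of `mellin_constKernel_add_one` as s → 0⁺. -/
theorem mellin_constKernel_one {a : ℝ} (ha : 0 < a) :
    mellin (fun t => (constKernel a t : ℂ)) 1 =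
      (((eulerMascheroniConstant - log (2 * π * a)) / 2 : ℝ) : ℂ) := by
  have hemb : Tendsto (fun x : ℝ => (x : ℂ)) (𝓝[>] 0) (𝓝[≠] 0) := by
    refine tendsto_nhdsWithin_iff.2 ⟨?_, ?_⟩
    · have := Complex.continuous_ofReal.tendsto 0
      rw [Complex.ofReal_zero] at this
      exact this.mono_left nhdsWithin_le_nhds
    · filter_upwards [self_mem_nhdsWithin] with x hx
      simpa using (mem_Ioi.1 hx).ne'
  have hadd : Tendsto (fun s : ℂ => s + 1) (𝓝[≠] 0) (𝓝[≠] 1) := by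
    refine tendsto_nhdsWithin_iff.2 ⟨?_, ?_⟩
    · have : Continuous fun s : ℂ => s + 1 := by fun_prop
      have := this.tendsto 0
      rw [zero_add] at this
      exact this.mono_left nhdsWithin_le_nhds
    · filter_upwards [self_mem_nhdsWithin] with x hx
      simpa using hx
  have hleft : Tendsto (fun x : ℝ => mellin (fun t => (constKernel a t : ℂ)) ((x : ℂ) + 1))
      (𝓝[>] 0) (𝓝 (mellin (fun t => (constKernel a t : ℂ)) 1)) :=
    (((mellin_constKernel_regular ha (s := 1) (by simp) (by simp)).2.continuousAt.tendsto.mono_left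
      nhdsWithin_le_nhds).comp hadd).comp hemb
  have hzeta := (hasDerivAt_iff_tendsto_slope.1
    (differentiableAt_riemannZeta (s := 0) zero_ne_one).hasDerivAt)
  have hpow : HasDerivAt (fun s : ℂ => (a : ℂ) ^ (-s)) (-(log a : ℂ)) 0 := by
    have := (hasDerivAt_neg (0 : ℂ)).const_cpow (c := (a : ℂ))
      (Or.inl (by exact_mod_cast ha.ne'))
    simpa [Complex.ofReal_log ha.le] using this
  have hpow0 : Tendsto (fun s : ℂ => (a : ℂ) ^ (-s)) (𝓝[≠] 0) (𝓝 1) := by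
    have := hpow.continuousAt.tendsto.mono_left (nhdsWithin_le_nhds (s := {0}ᶜ))
    simpa using this
  -- The poles ζ(0)/s = -1/(2s) and 1/(2s) cancel, leaving the limit ζ'(0) + (γ - log a)/2.
  have hright := (((Complex.tendsto_self_mul_Gamma_nhds_zero.mul (hzeta.add
    (((hpow0.mul (tendsto_riemannZeta_sub_one_div.comp hadd)).add
      (hasDerivAt_iff_tendsto_slope.1 hpow)).const_mul (1 / 2 : ℂ))))).comp hemb)
  have key := tendsto_nhds_unique_of_eventuallyEq hleft hright (by
    filter_upwards [Ioo_mem_nhdsGT one_pos] with x hx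
    have hx0 : (x : ℂ) ≠ 0 := by exact_mod_cast hx.1.ne'
    have ha0 : (a : ℂ) ≠ 0 := by exact_mod_cast ha.ne'
    rw [mellin_constKernel_add_one ha (by simpa using hx.1) (by simpa using hx.2)]
    simp only [Function.comp_apply, slope_def_field, riemannZeta_zero, sub_zero, neg_zero,
      Complex.cpow_zero, add_sub_cancel_right]
    rw [neg_add, Complex.cpow_add _ _ ha0, Complex.cpow_neg_one, Complex.Gamma_add_one _ hx0]
    field_simp
    ring_nf)
  rw [key, deriv_riemannZeta_zero, log_mul (by positivity) ha.ne']
  have hlog : Complex.log (2 * (π : ℂ)) = ((log (2 * π) : ℝ) : ℂ) := by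
    rw [Complex.ofReal_log (by positivity)]
    push_cast
    rfl
  rw [hlog, Complex.ofReal_div, Complex.ofReal_sub, Complex.ofReal_add, Complex.ofReal_ofNat]
  ring

theorem integrableOn_constKernel {a : ℝ} (ha : 0 < a) :
    IntegrableOn (constKernel a) (Ioi 0) := by
  have h := (mellin_constKernel_regular ha (s := 1) (by simp) (by simp)).1
  simp only [MellinConvergent, sub_self, Complex.cpow_zero, one_smul] at h
  exact h.re

theorem integral_constKernel {a : ℝ} (ha : 0 < a) :
    ∫ t in Ioi 0, constKernel a t = (eulerMascheroniConstant - log (2 * π * a)) / 2 := by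
  have h := mellin_constKernel_one ha
  simp only [mellin, sub_self, Complex.cpow_zero, one_smul] at h
  rw [integral_complex_ofReal] at h
  exact_mod_cast h

/-! ### The autocorrelation of `bose` as a series. -/

/-- The remainder `ψ(x) + 1 / (2 x) - log x`. -/
def psiRemainder (x : ℝ) : ℝ := psi x + 1 / (2 * x) - log x

theorem psiRemainder_eq {x : ℝ} (hx : 0 < x) : psiRemainder x = -binetIntegral x :=
  psi_add_inv_sub_log hx

theorem summable_binetIntegral {a : ℝ} (ha : 0 < a) :
    Summable fun n : ℕ => binetIntegral (((n : ℝ) + 1) * a) := by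
  have h := ((summable_nat_add_iff 1).2 (Real.summable_one_div_nat_pow.2 one_lt_two)).mul_left
    (1 / (4 * a ^ 2))
  refine Summable.of_nonneg_of_le (fun n => binetIntegral_nonneg _) (fun n => ?_) h
  refine (binetIntegral_le (by positivity)).trans (le_of_eq ?_)
  push_cast
  field_simp

theorem summable_psiRemainder {a : ℝ} (ha : 0 < a) :
    Summable fun n : ℕ => psiRemainder (((n : ℝ) + 1) * a) := by
  refine (summable_binetIntegral ha).neg.congr fun n => ?_
  rw [psiRemainder_eq (by positivity)]

theorem tsum_binetIntegral {a : ℝ} (ha : 0 < a) :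
    ∑' n : ℕ, binetIntegral (((n : ℝ) + 1) * a) =
      ∫ t in Ioi 0, (bose t + 1 / 2) * (exp (a * t) - 1)⁻¹ := by
  have h := hasSum_integral_of_summable_integral_norm (μ := volume.restrict (Ioi (0 : ℝ)))
    (F := fun (n : ℕ) t => (bose t + 1 / 2) * exp (-(((n : ℝ) + 1) * a * t)))
    (fun n => integrableOn_binet (by positivity)) ?_
  · refine h.tsum_eq.trans (setIntegral_congr_fun measurableSet_Ioi fun t ht => ?_)
    have := (hasSum_exp_neg_succ_mul (mul_pos ha (mem_Ioi.1 ht))).mul_left (bose t + 1 / 2)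
    simp only [← mul_assoc] at this
    exact this.tsum_eq
  · refine (summable_binetIntegral ha).congr fun n => ?_
    refine setIntegral_congr_fun measurableSet_Ioi fun t ht => ?_
    exact (norm_of_nonneg (mul_nonneg (bose_add_half_nonneg ht) (exp_pos _).le)).symm

/-- From sinh u ≥ u at u = x/2. The bound serves near 0 and at infinity simultaneously. -/
theorem inv_exp_sub_one_le_exp {x : ℝ} (hx : 0 < x) : (exp x - 1)⁻¹ ≤ x⁻¹ * exp (-(x / 2)) := by
  have h := self_le_sinh_iff.2 (by positivity : 0 ≤ x / 2)
  rw [sinh_eq] at h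
  have h1 : exp x - 1 = exp (x / 2) * (exp (x / 2) - exp (-(x / 2))) := by
    rw [mul_sub, ← exp_add, ← exp_add]
    simp
  rw [h1, mul_inv, exp_neg (x / 2), mul_comm, ← exp_neg]
  exact mul_le_mul_of_nonneg_right (inv_anti₀ hx (by linarith)) (exp_pos _).le

theorem integrableOn_bose_add_half_mul {a : ℝ} (ha : 0 < a) :
    IntegrableOn (fun t => (bose t + 1 / 2) * (exp (a * t) - 1)⁻¹) (Ioi 0) := by
  have hc : ContinuousOn (fun t => (bose t + 1 / 2) * (exp (a * t) - 1)⁻¹) (Ioi 0) :=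
    (continuousOn_bose.add continuousOn_const).mul
      (continuousOn_inv_exp_sub_one.comp (by fun_prop) fun t ht => mul_pos ha ht)
  refine Integrable.mono' ((integrableOn_exp_neg_mul (half_pos ha)).const_mul (4 * a)⁻¹)
    (hc.aestronglyMeasurable measurableSet_Ioi)
    ((ae_restrict_iff' measurableSet_Ioi).2 (Eventually.of_forall fun t ht => ?_))
  have ht : 0 < t := ht
  have hat := mul_pos ha ht
  rw [norm_of_nonneg (mul_nonneg (bose_add_half_nonneg ht) (inv_pos.2 (exp_sub_one_pos hat)).le)]
  refine (mul_le_mul (bose_add_half_le ht) (inv_exp_sub_one_le_exp hat)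
    (inv_pos.2 (exp_sub_one_pos hat)).le (by positivity)).trans (le_of_eq ?_)
  rw [show a * t / 2 = a / 2 * t by ring]
  field_simp

/-- Adding and subtracting half of 1/(e^{at} - 1) splits the product into two separately integrable
parts. -/
theorem bose_mul_bose_eq {a t : ℝ} (ha : 0 < a) (ht : 0 < t) :
    bose t * bose (a * t) =
      (bose t + 1 / 2) * (exp (a * t) - 1)⁻¹ - a⁻¹ * constKernel a t := by
  unfold constKernel bose
  field_simp
  ring

theorem integral_bose_mul_bose {a : ℝ} (ha : 0 < a) :
    ∫ t in Ioi 0, bose t * bose (a * t) =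
      -((eulerMascheroniConstant - log (2 * π * a)) / (2 * a) +
        ∑' n : ℕ, psiRemainder (((n : ℝ) + 1) * a)) := by
  have h1 : ∑' n : ℕ, psiRemainder (((n : ℝ) + 1) * a) =
      -∫ t in Ioi 0, (bose t + 1 / 2) * (exp (a * t) - 1)⁻¹ := by
    rw [← tsum_binetIntegral ha, ← tsum_neg]
    exact tsum_congr fun n => psiRemainder_eq (by positivity)
  rw [setIntegral_congr_fun measurableSet_Ioi fun t ht => bose_mul_bose_eq ha ht,
    integral_sub (integrableOn_bose_add_half_mul ha) ((integrableOn_constKernel ha).const_mul _),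
    integral_const_mul, integral_constKernel ha, h1]
  field_simp
  ring_nf

/-! ### Duplication, and τ in terms of the remainder of ψ. -/

theorem psi_duplication {x : ℝ} (hx : 0 < x) :
    psi x + psi (x + 1 / 2) = 2 * psi (2 * x) - 2 * log 2 := by
  have h1 : HasDerivAt (fun s => log (Gamma s) + log (Gamma (s + 1 / 2)))
      (psi x + psi (x + 1 / 2)) x :=
    (hasDerivAt_log_Gamma hx).add
      ((hasDerivAt_log_Gamma (by linarith : 0 < x + 1 / 2)).comp_add_const x (1 / 2))
  have h2 : HasDerivAt (fun s => log (Gamma (2 * s)) + (1 - 2 * s) * log 2 + log (√π))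
      (psi (2 * x) * 2 + -2 * log 2) x := by
    have ha : HasDerivAt (fun s : ℝ => 2 * s) 2 x := by
      simpa using (hasDerivAt_id x).const_mul 2
    exact (((hasDerivAt_log_Gamma (by positivity : 0 < 2 * x)).comp x ha).add
      ((ha.const_sub 1).mul_const (log 2))).add_const _
  have h3 : (fun s => log (Gamma s) + log (Gamma (s + 1 / 2))) =ᶠ[𝓝 x]
      fun s => log (Gamma (2 * s)) + (1 - 2 * s) * log 2 + log (√π) := by
    filter_upwards [Ioi_mem_nhds hx] with s hs
    have hs : 0 < s := hs
    have g1 := (Gamma_pos_of_pos hs).ne'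
    have g2 := (Gamma_pos_of_pos (by linarith : 0 < s + 1 / 2)).ne'
    have g3 := (Gamma_pos_of_pos (by linarith : 0 < 2 * s)).ne'
    have g4 : (2 : ℝ) ^ (1 - 2 * s) ≠ 0 := (rpow_pos_of_pos two_pos _).ne'
    have g5 : √π ≠ 0 := (sqrt_pos.2 pi_pos).ne'
    rw [← log_mul g1 g2, Gamma_mul_Gamma_add_half, log_mul (mul_ne_zero g3 g4) g5,
      log_mul g3 g4, log_rpow two_pos]
  have := h1.unique (h2.congr_of_eventuallyEq h3)
  linarith

theorem tau_eq_psiRemainder {x : ℝ} (hx : 0 < x) :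
    tau x = psiRemainder (x / 2) - 2 * psiRemainder x + 2 * psiRemainder (2 * x) := by
  have h1 := psi_add_one (half_pos hx)
  have h2 := psi_duplication (half_pos hx)
  have h3 := psi_duplication hx
  have h4 : log (x / 2) = log x - log 2 := log_div hx.ne' two_ne_zero
  have h5 : log (2 * x) = log 2 + log x := log_mul two_ne_zero hx.ne'
  rw [mul_div_cancel₀ _ (two_ne_zero' ℝ)] at h2
  unfold tau psiRemainder
  rw [show (1 + x) / 2 = x / 2 + 1 / 2 by ring, add_comm 1 (x / 2), h1, h4, h5]
  have h6 : psi (x / 2 + 1 / 2) = 2 * psi x - 2 * log 2 - psi (x / 2) := by linarith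
  have h7 : psi (x + 1 / 2) = 2 * psi (2 * x) - 2 * log 2 - psi x := by linarith
  rw [h6, h7]
  field_simp
  ring

theorem tau_succ_mul {a : ℝ} (ha : 0 < a) (n : ℕ) :
    tau (((n : ℝ) + 1) * a) = psiRemainder (((n : ℝ) + 1) * (a / 2)) -
      2 * psiRemainder (((n : ℝ) + 1) * a) + 2 * psiRemainder (((n : ℝ) + 1) * (2 * a)) := by
  rw [tau_eq_psiRemainder (by positivity)]
  ring_nf

theorem summable_tau {a : ℝ} (ha : 0 < a) :
    Summable fun n : ℕ => tau (((n : ℝ) + 1) * a) := by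
  simp only [tau_succ_mul ha]
  exact ((summable_psiRemainder (half_pos ha)).sub ((summable_psiRemainder ha).mul_left 2)).add
    ((summable_psiRemainder (by positivity : 0 < 2 * a)).mul_left 2)

/-- The multiplicative autocorrelation `√a ∫ f(t) f(a t) dt` of `f(t) = 1 / (e^t - 1) - 1 / t`. -/
def boseCorrelation (a : ℝ) : ℝ := √a * ∫ t in Ioi 0, bose t * bose (a * t)

/-- The weights √2, 2, √2 absorb √(a/2) and √(2a) into √a; the log 2 parts of the constant terms
cancel. -/
theorem modularSide_eq_boseCorrelation {a : ℝ} (ha : 0 < a) :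
    modularSide a = -(√2 * boseCorrelation (a / 2) - 2 * boseCorrelation a +
      √2 * boseCorrelation (2 * a)) := by
  have s1 := summable_psiRemainder (half_pos ha)
  have s2 := summable_psiRemainder ha
  have s3 := summable_psiRemainder (by positivity : 0 < 2 * a)
  have hs : ∑' n : ℕ, tau (((n : ℝ) + 1) * a) =
      ∑' n : ℕ, psiRemainder (((n : ℝ) + 1) * (a / 2)) -
      2 * ∑' n : ℕ, psiRemainder (((n : ℝ) + 1) * a) +
      2 * ∑' n : ℕ, psiRemainder (((n : ℝ) + 1) * (2 * a)) := by
    rw [← tsum_mul_left, ← tsum_mul_left, ← s1.tsum_sub (s2.mul_left 2),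
      ← (s1.sub (s2.mul_left 2)).tsum_add (s3.mul_left 2)]
    exact tsum_congr fun n => tau_succ_mul ha n
  have l1 : log (2 * π * (a / 2)) = log (π * a) := by ring_nf
  have l2 : log (2 * π * a) = log 2 + log (π * a) := by
    rw [mul_assoc, log_mul two_ne_zero (by positivity)]
  have l3 : log (2 * π * (2 * a)) = 2 * log 2 + log (π * a) := by
    rw [show 2 * π * (2 * a) = 2 * (2 * (π * a)) by ring, log_mul two_ne_zero (by positivity),
      log_mul two_ne_zero (by positivity)]
    ring
  have r1 : √2 * √(a / 2) = √a := by
    rw [← sqrt_mul zero_le_two]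
    congr 1
    ring
  have r2 : √2 * √(2 * a) = 2 * √a := by
    rw [sqrt_mul zero_le_two, ← mul_assoc, mul_self_sqrt zero_le_two]
  unfold modularSide boseCorrelation
  rw [← mul_assoc (√2), ← mul_assoc (√2), r1, r2, integral_bose_mul_bose ha,
    integral_bose_mul_bose (half_pos ha), integral_bose_mul_bose (by positivity : 0 < 2 * a),
    hs, l1, l2, l3]
  field_simp
  ring

/-! ### Fourier inversion for nonnegative transforms and Wiener-Khinchin. -/

theorem tendsto_integral_gaussian_mul_fourier {F : ℝ → ℂ} (hF : Integrable F)
    (hc : ContinuousAt F 0) :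
    Tendsto (fun c : ℝ => ∫ w : ℝ, Complex.exp (-c⁻¹ * ‖w‖ ^ 2) * 𝓕 F w) atTop (𝓝 (F 0)) := by
  refine (Real.tendsto_integral_gaussian_smul' hF hc).congr' ?_
  filter_upwards [Ioi_mem_atTop 0] with c (hc : 0 < c)
  have J : Integrable (fun w : ℝ => Complex.exp (-c⁻¹ * ‖w‖ ^ 2)) := by
    have := GaussianFourier.integrable_cexp_neg_mul_sq_norm_add (V := ℝ) (b := (c : ℂ)⁻¹)
      (by simpa) 0 0
    simpa using this
  have h := (VectorFourier.integral_fourierIntegral_smul_eq_flip (L := innerₗ ℝ)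
      Real.continuous_fourierChar continuous_inner J hF)
  rw [flip_innerₗ] at h
  refine Eq.trans ?_ h
  congr with w
  have hb : 0 < ((c : ℂ)⁻¹).re := by simpa
  have h2 := fourier_gaussian_innerProductSpace' (V := ℝ) hb 0 w
  simp only [inner_zero_left, Complex.ofReal_zero, mul_zero, add_zero] at h2
  have h3 : VectorFourier.fourierIntegral 𝐞 volume (innerₗ ℝ)
      (fun w : ℝ => Complex.exp (-(c : ℂ)⁻¹ * ‖w‖ ^ 2)) w = _ := h2
  rw [Complex.ofReal_inv, h3]
  simp only [div_inv_eq_mul]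
  congr 3
  ring

/-- An integrable function, continuous at the origin, whose Fourier transform is nonnegative has
an integrable Fourier transform. -/
theorem integrable_fourier_of_nonneg {F : ℝ → ℂ} (hF : Integrable F) (hc : ContinuousAt F 0)
    {h : ℝ → ℝ} (h0 : ∀ x, 0 ≤ h x) (hh : ∀ x, 𝓕 F x = h x) : Integrable (𝓕 F) := by
  have hcont : Continuous (𝓕 F) :=
    VectorFourier.fourierIntegral_continuous Real.continuous_fourierChar continuous_inner hF
  have hre : h = fun x => (𝓕 F x).re := by
    funext x
    rw [hh, Complex.ofReal_re]
  have hhc : Continuous h := hre ▸ Complex.continuous_re.comp hcont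
  have hbound : ∀ x, ‖h x‖ ≤ ∫ v, ‖F v‖ := fun x => by
    have := VectorFourier.norm_fourierIntegral_le_integral_norm 𝐞 volume (innerₗ ℝ) F x
    have e : VectorFourier.fourierIntegral 𝐞 volume (innerₗ ℝ) F x = h x := hh x
    rwa [e, Complex.norm_real] at this
  set G : ℕ → ℝ → ℝ := fun n w => exp (-((n : ℝ) + 1)⁻¹ * w ^ 2) * h w
  have hGint : ∀ n, Integrable (G n) := fun n =>
    (integrable_exp_neg_mul_sq (b := ((n : ℝ) + 1)⁻¹) (by positivity)).mul_bdd
      hhc.aestronglyMeasurable (Eventually.of_forall hbound)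
  have hlim : Tendsto (fun n => ∫ w, G n w) atTop (𝓝 (F 0).re) := by
    have h1 := (Complex.continuous_re.tendsto _).comp
      ((tendsto_integral_gaussian_mul_fourier hF hc).comp
      (tendsto_atTop_add_const_right _ 1 tendsto_natCast_atTop_atTop : Tendsto
        (fun n : ℕ => (n : ℝ) + 1) atTop atTop))
    refine h1.congr fun n => ?_
    simp only [Function.comp_apply]
    rw [← Complex.ofReal_re (∫ w, G n w), ← integral_complex_ofReal]
    congr 2
    funext w
    simp only [hh, G]
    push_cast
    congr 3
    norm_cast
    simp
  -- Fatou: since `h` is nonnegative, the L¹ norms of `G n` are their integrals, which converge to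
  -- `(F 0).re`.
  have hint : Integrable h := by
    refine integrable_of_tendsto (G := G) (Eventually.of_forall fun w => ?_)
      (fun n => (hGint n).aestronglyMeasurable) ?_
    · have h1 : Tendsto (fun n : ℕ => exp (-((n : ℝ) + 1)⁻¹ * w ^ 2)) atTop (𝓝 1) := by
        have h2 : Tendsto (fun n : ℕ => -((n : ℝ) + 1)⁻¹ * w ^ 2) atTop (𝓝 0) := by
          have := (tendsto_one_div_add_atTop_nhds_zero_nat (𝕜 := ℝ)).neg.mul_const (w ^ 2)
          simpa using this
        have := (continuous_exp.tendsto 0).comp h2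
        rwa [exp_zero] at this
      simpa [G] using h1.mul_const (h w)
    · have e : ∀ n, ∫⁻ x, ‖G n x‖ₑ = ENNReal.ofReal (∫ x, G n x) := fun n => by
        have hp : ∀ x, 0 ≤ G n x := fun x => mul_nonneg (exp_pos _).le (h0 x)
        rw [ofReal_integral_eq_lintegral_ofReal (hGint n) (Eventually.of_forall hp)]
        exact lintegral_congr fun x => Real.enorm_of_nonneg (hp x)
      simp only [e]
      have := ((ENNReal.continuous_ofReal.tendsto _).comp hlim).liminf_eq
      simp only [Function.comp_def] at this
      rw [this]
      exact ENNReal.ofReal_ne_top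
  have : 𝓕 F = fun x => (h x : ℂ) := funext hh
  rw [this]
  exact hint.ofReal

/-- The Wiener-Khinchin formula for a bounded continuous integrable real function. -/
theorem integral_mul_comp_add_eq {g : ℝ → ℝ} (hg : Integrable g) (hc : Continuous g) {C : ℝ}
    (hC : ∀ x, ‖g x‖ ≤ C) :
    Integrable (fun x => ‖𝓕 (fun u => (g u : ℂ)) x‖ ^ 2) ∧
    ∀ v, ((∫ u, g u * g (u + v) : ℝ) : ℂ) =
      ∫ x : ℝ, Complex.exp ((2 * π * x * v : ℝ) * Complex.I) *
        ((‖𝓕 (fun u => (g u : ℂ)) x‖ ^ 2 : ℝ) : ℂ) := by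
  set f : ℝ → ℂ := fun u => (g u : ℂ)
  set f' : ℝ → ℂ := fun u => (g (-u) : ℂ)
  have hf : Integrable f := hg.ofReal
  have hf' : Integrable f' := hf.comp_neg
  have hfc : Continuous f := Complex.continuous_ofReal.comp hc
  -- Convolving with the reflection gives the autocorrelation; as `g` is real, its transform is |𝓕
  -- f|² ≥ 0.
  set A : ℝ → ℂ := f' ⋆[ContinuousLinearMap.mul ℂ ℂ] f
  have hA : Integrable A := hf'.integrable_convolution _ hf
  have hAc : Continuous A := by
    refine BddAbove.continuous_convolution_right_of_integrable _ ⟨C, ?_⟩ hf' hfc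
    rintro _ ⟨x, rfl⟩
    simpa [f] using hC x
  have hconj : ∀ x, 𝓕 f' x = (starRingEnd ℂ) (𝓕 f x) := fun x => by
    rw [Real.fourier_real_eq_integral_exp_smul, Real.fourier_real_eq_integral_exp_smul,
      ← integral_conj, ← integral_neg_eq_self]
    refine integral_congr_ae (Eventually.of_forall fun u => ?_)
    simp only [f, f', smul_eq_mul, map_mul, Complex.conj_ofReal, ← Complex.exp_conj, Complex.conj_I,
      neg_neg]
    congr 2
    push_cast
    ring
  have hFA : ∀ x, 𝓕 A x = ((‖𝓕 f x‖ ^ 2 : ℝ) : ℂ) := fun x => by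
    rw [Real.fourier_mul_convolution_eq hf' hf, hconj, mul_comm, Complex.mul_conj,
      Complex.normSq_eq_norm_sq]
  have hFint := integrable_fourier_of_nonneg hA hAc.continuousAt (fun x => sq_nonneg _) hFA
  have hfun : 𝓕 A = fun x => ((‖𝓕 f x‖ ^ 2 : ℝ) : ℂ) := funext hFA
  refine ⟨?_, fun v => ?_⟩
  · rw [hfun] at hFint
    exact hFint.re
  · have hinv := congrFun (hAc.fourierInv_fourier_eq hA hFint) v
    have hAv : A v = ((∫ u, g u * g (u + v) : ℝ) : ℂ) := by
      rw [← integral_complex_ofReal]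
      simp only [A, convolution_def, ContinuousLinearMap.mul_apply']
      rw [← integral_neg_eq_self]
      refine integral_congr_ae (Eventually.of_forall fun u => ?_)
      simp only [f, f', neg_neg, sub_neg_eq_add]
      push_cast
      rw [add_comm]
    rw [← hAv, ← hinv, Real.fourierInv_eq']
    refine integral_congr_ae (Eventually.of_forall fun x => ?_)
    simp only [hFA, smul_eq_mul]
    congr 4
    simp
    ring

/-! ### The autocorrelation as a cosine integral on the critical line. -/

/-- The function `e^(-u/2) f(e^(-u))` for `f(t) = 1 / (e^t - 1) - 1 / t`. -/
def logBose (u : ℝ) : ℝ := exp (-(1 / 2) * u) * bose (exp (-u))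

theorem continuous_logBose : Continuous logBose := by
  have h : Continuous fun u : ℝ => bose (exp (-u)) :=
    continuousOn_bose.comp_continuous (by fun_prop) fun u => exp_pos _
  unfold logBose
  fun_prop

theorem norm_logBose_le (u : ℝ) : ‖logBose u‖ ≤ 1 := by
  have hb : ‖bose (exp (-u))‖ ≤ 1 / 2 := by
    simpa using norm_bose_le_half (exp_pos (-u))
  have hb' : ‖bose (exp (-u))‖ ≤ exp u := by
    simpa [← exp_neg] using norm_bose_le_inv (exp_pos (-u))
  rw [logBose, norm_mul, norm_of_nonneg (exp_pos _).le]
  rcases le_total 0 u with hu | hu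
  · have : exp (-(1 / 2) * u) ≤ 1 := exp_le_one_iff.2 (by linarith)
    nlinarith [norm_nonneg (bose (exp (-u)))]
  · refine (mul_le_mul_of_nonneg_left hb' (exp_pos _).le).trans ?_
    rw [← exp_add]
    exact exp_le_one_iff.2 (by linarith)

theorem image_exp_neg_univ : (fun u : ℝ => exp (-u)) '' univ = Ioi 0 := by
  have : (fun u : ℝ => exp (-u)) = exp ∘ Neg.neg := rfl
  rw [this, image_comp, image_univ_of_surjective neg_surjective, image_univ, range_exp]

theorem hasDerivWithinAt_exp_neg (u : ℝ) (_ : u ∈ univ) :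
    HasDerivWithinAt (fun u : ℝ => exp (-u)) (-exp (-u)) univ u := by
  have : HasDerivAt (fun u : ℝ => exp (-u)) (-exp (-u)) u := by
    simpa using (hasDerivAt_neg u).exp
  exact this.hasDerivWithinAt

theorem injOn_exp_neg : InjOn (fun u : ℝ => exp (-u)) univ := fun x _ y _ h => by
  simpa using h

theorem integral_comp_exp_neg (F : ℝ → ℝ) :
    ∫ x in Ioi 0, F x = ∫ u, exp (-u) * F (exp (-u)) := by
  rw [← image_exp_neg_univ, integral_image_eq_integral_abs_deriv_smul MeasurableSet.univ
    hasDerivWithinAt_exp_neg injOn_exp_neg]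
  simp

theorem integrable_logBose : Integrable logBose := by
  have h := mellinConvergent_bose (s := 1 / 2) (by norm_num) (by norm_num)
  rw [MellinConvergent, ← image_exp_neg_univ,
    integrableOn_image_iff_integrableOn_abs_deriv_smul MeasurableSet.univ
      hasDerivWithinAt_exp_neg injOn_exp_neg, integrableOn_univ] at h
  refine h.re.congr (Eventually.of_forall fun u => ?_)
  have e : ((exp (-u) : ℝ) : ℂ) ^ ((1 / 2 : ℂ) - 1) = ((exp (1 / 2 * u) : ℝ) : ℂ) := by
    rw [show ((1 / 2 : ℂ) - 1) = ((-(1 / 2) : ℝ) : ℂ) by push_cast; ring,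
      ← Complex.ofReal_cpow (exp_pos _).le, ← exp_mul]
    ring_nf
  simp only [e, abs_neg, abs_of_pos (exp_pos _), smul_eq_mul, Complex.real_smul, logBose]
  rw [← Complex.ofReal_mul, ← Complex.ofReal_mul]
  simp only [RCLike.re_eq_complex_re, Complex.ofReal_re]
  rw [← mul_assoc, ← exp_add]
  ring_nf

/-- `|Γ(1/2 + i t/2) ζ(1/2 + i t/2)|²`. -/
def critWeight (t : ℝ) : ℝ :=
  ‖Complex.Gamma (1 / 2 + (t / 2 : ℝ) * Complex.I) *
    riemannZeta (1 / 2 + (t / 2 : ℝ) * Complex.I)‖ ^ 2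

theorem critWeight_neg (t : ℝ) : critWeight (-t) = critWeight t := by
  have h : (1 / 2 + ((-t / 2 : ℝ) : ℂ) * Complex.I) =
      (starRingEnd ℂ) (1 / 2 + ((t / 2 : ℝ) : ℂ) * Complex.I) := by
    rw [map_add, map_mul, Complex.conj_ofReal, Complex.conj_I, map_div₀, map_one, map_ofNat]
    push_cast
    ring
  rw [critWeight, h, Complex.Gamma_conj, riemannZeta_conj, ← map_mul, Complex.norm_conj, critWeight]

/-- Fourier frequency x corresponds to the Mellin variable 1/2 + 2πix, so t/2 = 2πx. -/
theorem norm_fourier_logBose (x : ℝ) :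
    ‖𝓕 (fun u => (logBose u : ℂ)) x‖ ^ 2 = critWeight (4 * π * x) := by
  have h := mellin_eq_fourier (fun t => (bose t : ℂ))
    (s := 1 / 2 + ((4 * π * x / 2 : ℝ) : ℂ) * Complex.I)
  rw [mellin_bose (by simp) (by simp; norm_num)] at h
  rw [critWeight, h]
  congr 2
  have e : (1 / 2 + ((4 * π * x / 2 : ℝ) : ℂ) * Complex.I).im / (2 * π) = x := by
    simp
    field_simp
    ring
  have e' : (1 / 2 + ((4 * π * x / 2 : ℝ) : ℂ) * Complex.I).re = 1 / 2 := by simp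
  rw [e, e']
  have hfun : (fun u => (logBose u : ℂ)) =
      fun u => exp (-(1 / 2) * u) • (bose (exp (-u)) : ℂ) := by
    funext u
    simp [logBose]
  rw [hfun]

/-- Integrability comes from Wiener-Khinchin, so no growth estimate for ζ on the critical line is
needed. -/
theorem integrable_critWeight : Integrable critWeight := by
  have h := (integral_mul_comp_add_eq integrable_logBose continuous_logBose norm_logBose_le).1
  simp only [norm_fourier_logBose] at h
  exact (integrable_comp_mul_left_iff critWeight (by positivity : 4 * π ≠ 0)).1 h

theorem integrable_cos_mul_critWeight (a : ℝ) :
    Integrable fun t => cos (1 / 2 * t * log a) * critWeight t :=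
  integrable_critWeight.bdd_mul (Continuous.aestronglyMeasurable (by fun_prop))
    (c := 1) (Eventually.of_forall fun t => abs_cos_le_one _)

theorem boseCorrelation_eq_integral {a : ℝ} (ha : 0 < a) :
    boseCorrelation a = 1 / (2 * π) * ∫ t in Ioi 0, cos (1 / 2 * t * log a) * critWeight t := by
  have h := (integral_mul_comp_add_eq integrable_logBose continuous_logBose norm_logBose_le).2
    (-log a)
  have h1 : ∫ u, logBose u * logBose (u + -log a) = boseCorrelation a := by
    rw [boseCorrelation, integral_comp_exp_neg, ← integral_const_mul]
    refine integral_congr_ae (Eventually.of_forall fun u => ?_)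
    have e1 : exp (-(u + -log a)) = a * exp (-u) := by
      rw [neg_add, neg_neg, exp_add, exp_log ha, mul_comm]
    have e2 : exp (-(1 / 2) * u) * exp (-(1 / 2) * (u + -log a)) = √a * exp (-u) := by
      rw [sqrt_eq_rpow, rpow_def_of_pos ha, ← exp_add, ← exp_add]
      ring_nf
    simp only [logBose, e1]
    linear_combination (bose (exp (-u)) * bose (a * exp (-u))) * e2
  simp only [h1, norm_fourier_logBose] at h
  have hint : Integrable fun x : ℝ => Complex.exp ((2 * π * x * -log a : ℝ) * Complex.I) *
      ((critWeight (4 * π * x) : ℝ) : ℂ) := by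
    refine Integrable.bdd_mul (c := 1) ((integrable_critWeight.comp_mul_left'
      (by positivity : 4 * π ≠ 0)).ofReal) (Continuous.aestronglyMeasurable (by fun_prop))
      (Eventually.of_forall fun x => ?_)
    rw [Complex.norm_exp_ofReal_mul_I]
  have h2 : boseCorrelation a =
      ∫ x : ℝ, cos (1 / 2 * (4 * π * x) * log a) * critWeight (4 * π * x) := by
    have := congrArg Complex.re h
    rw [Complex.ofReal_re, ← RCLike.re_eq_complex_re, ← integral_re hint] at this
    rw [this]
    refine integral_congr_ae (Eventually.of_forall fun x => ?_)
    simp only [RCLike.re_eq_complex_re]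
    rw [Complex.re_mul_ofReal, Complex.exp_ofReal_mul_I_re, ← cos_neg]
    ring_nf
  have h3 : ∫ t : ℝ, cos (1 / 2 * t * log a) * critWeight t =
      2 * ∫ t in Ioi 0, cos (1 / 2 * t * log a) * critWeight t := by
    rw [← integral_comp_abs (f := fun t => cos (1 / 2 * t * log a) * critWeight t)]
    refine integral_congr_ae (Eventually.of_forall fun t => ?_)
    rcases abs_choice t with ht | ht
    · simp only [ht]
    · simp only [ht, critWeight_neg]
      rw [← cos_neg]
      ring_nf
  rw [h2, Measure.integral_comp_mul_left (fun t => cos (1 / 2 * t * log a) * critWeight t) (4 * π),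
    h3, smul_eq_mul, abs_of_pos (by positivity)]
  generalize ∫ t in Ioi 0, cos (1 / 2 * t * log a) * critWeight t = J
  field_simp
  ring

theorem integrable_cos_mul_sub_one_mul_critWeight (a : ℝ) :
    Integrable fun t => cos (1 / 2 * t * log a) * (√2 * cos (1 / 2 * t * log 2) - 1) *
      critWeight t := by
  refine integrable_critWeight.bdd_mul (c := 1 * (√2 * 1 + 1))
    (Continuous.aestronglyMeasurable (by fun_prop)) (Eventually.of_forall fun t => ?_)
  rw [norm_mul]
  refine mul_le_mul (abs_cos_le_one _) ?_ (norm_nonneg _) zero_le_one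
  refine (norm_sub_le _ _).trans ?_
  rw [norm_mul, norm_one, norm_of_nonneg (sqrt_nonneg 2)]
  gcongr
  exact abs_cos_le_one _

/-- The dilations a/2 and 2a shift the phase by ∓½ t log 2; in the sum the sine products cancel. -/
theorem modularSide_eq_integral {a : ℝ} (ha : 0 < a) :
    modularSide a = -(1 / π * ∫ t in Ioi 0, cos (1 / 2 * t * log a) *
      (√2 * cos (1 / 2 * t * log 2) - 1) * critWeight t) := by
  have hi := fun b => (integrable_cos_mul_critWeight b).integrableOn (s := Ioi 0)
  have key : 2 * ∫ t in Ioi 0, cos (1 / 2 * t * log a) *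
      (√2 * cos (1 / 2 * t * log 2) - 1) * critWeight t =
      √2 * (∫ t in Ioi 0, cos (1 / 2 * t * log (a / 2)) * critWeight t) -
      2 * (∫ t in Ioi 0, cos (1 / 2 * t * log a) * critWeight t) +
      √2 * ∫ t in Ioi 0, cos (1 / 2 * t * log (2 * a)) * critWeight t := by
    simp only [← integral_const_mul]
    rw [← integral_sub ((hi _).const_mul _) ((hi _).const_mul _),
      ← integral_add (by exact ((hi _).const_mul _).sub ((hi _).const_mul _)) ((hi _).const_mul _)]
    refine integral_congr_ae (Eventually.of_forall fun t => ?_)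
    have e1 : cos (1 / 2 * t * log (a / 2)) = cos (1 / 2 * t * log a) * cos (1 / 2 * t * log 2) +
        sin (1 / 2 * t * log a) * sin (1 / 2 * t * log 2) := by
      rw [log_div ha.ne' two_ne_zero, mul_sub, cos_sub]
    have e2 : cos (1 / 2 * t * log (2 * a)) = cos (1 / 2 * t * log a) * cos (1 / 2 * t * log 2) -
        sin (1 / 2 * t * log a) * sin (1 / 2 * t * log 2) := by
      rw [log_mul two_ne_zero ha.ne', add_comm, mul_add, cos_add]
    simp only [e1, e2]
    ring
  rw [modularSide_eq_boseCorrelation ha, boseCorrelation_eq_integral ha,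
    boseCorrelation_eq_integral (half_pos ha), boseCorrelation_eq_integral (by positivity)]
  have hpi := pi_ne_zero
  generalize ∫ t in Ioi 0, cos (1 / 2 * t * log a) *
      (√2 * cos (1 / 2 * t * log 2) - 1) * critWeight t = J at key ⊢
  generalize ∫ t in Ioi 0, cos (1 / 2 * t * log (a / 2)) * critWeight t = J₁ at key ⊢
  generalize ∫ t in Ioi 0, cos (1 / 2 * t * log a) * critWeight t = J₂ at key ⊢
  generalize ∫ t in Ioi 0, cos (1 / 2 * t * log (2 * a)) * critWeight t = J₃ at key ⊢
  field_simp
  linear_combination key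

/-! ### From |Γζ|² to Ξ². -/

theorem xi_eq_completedRiemannZeta {s : ℂ} (hs : s ≠ 0) (hG : Complex.Gammaℝ s ≠ 0) :
    xi s = s * (s - 1) / 2 * completedRiemannZeta s := by
  have hs2 : s / 2 ≠ 0 := div_ne_zero hs two_ne_zero
  have hz : completedRiemannZeta s = Complex.Gammaℝ s * riemannZeta s := by
    rw [riemannZeta_def_of_ne_zero hs]
    field_simp
  rw [hz, xi, add_comm 1, Complex.Gamma_add_one _ hs2, Complex.Gammaℝ_def]
  ring

theorem critWeight_eq {s : ℂ} {t : ℝ} (hs : s = 1 / 2 + (t / 2 : ℝ) * Complex.I) :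
    (critWeight t : ℂ) =
      Complex.Gamma s * riemannZeta s * (Complex.Gamma (1 - s) * riemannZeta (1 - s)) := by
  have hc : 1 - s = (starRingEnd ℂ) s := by
    rw [hs, map_add, map_mul, Complex.conj_ofReal, Complex.conj_I, map_div₀, map_one, map_ofNat]
    ring
  rw [critWeight, ← hs, hc, Complex.Gamma_conj, riemannZeta_conj, ← map_mul, Complex.mul_conj,
    Complex.normSq_eq_norm_sq]

/-- With s = 1/2 + it/2, the left Gamma factor is Γ((s - 1)/2)Γ(-s/2). Raising each argument by 1
gives Γ((s + 1)/2)Γ(1 - s/2), which pairs by Legendre duplication with the Γ(s/2)Γ((1 - s)/2) inside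
Ξ² to yield Γ(s)Γ(1 - s). -/
theorem norm_Gamma_sq_mul_Xi_sq (t : ℝ) :
    ((‖Complex.Gamma ((-1 + Complex.I * t) / 4)‖ ^ 2 : ℝ) : ℂ) * Xi (t / 2) ^ 2 =
      (√π / 2 * (1 + t ^ 2) * critWeight t : ℝ) := by
  obtain ⟨s, hs⟩ : ∃ s : ℂ, s = 1 / 2 + (t / 2 : ℝ) * Complex.I := ⟨_, rfl⟩
  have hre : s.re = 1 / 2 := by simp [hs]
  have hs0 : s ≠ 0 := fun h => by norm_num [h] at hre
  have hs1 : s - 1 ≠ 0 := fun h => by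
    rw [sub_eq_zero.1 h] at hre
    norm_num at hre
  have hs1' : 1 - s ≠ 0 := fun h => hs1 (by linear_combination -h)
  have hG := Complex.Gammaℝ_ne_zero_of_re_pos (s := s) (by rw [hre]; norm_num)
  have hG' := Complex.Gammaℝ_ne_zero_of_re_pos (s := 1 - s) (by simp [hre]; norm_num)
  have hz := riemannZeta_def_of_ne_zero hs0
  have hz' := riemannZeta_def_of_ne_zero hs1'
  have hX : Xi (t / 2) = s * (s - 1) / 2 * completedRiemannZeta s := by
    rw [Xi, show (1 / 2 + Complex.I * ((t / 2 : ℝ) : ℂ)) = s by rw [hs]; ring,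
      xi_eq_completedRiemannZeta hs0 hG]
  -- The functional equation reflects one of the two equal zeta factors, so that s and 1 - s = conj
  -- s appear symmetrically.
  have hX2 : Xi (t / 2) ^ 2 = (s * (s - 1) / 2) ^ 2 * (Complex.Gammaℝ s * riemannZeta s *
      (Complex.Gammaℝ (1 - s) * riemannZeta (1 - s))) := by
    rw [hX, hz, hz', completedRiemannZeta_one_sub]
    field_simp
  have hA : (-1 + Complex.I * t) / 4 = (s - 1) / 2 := by
    rw [hs]
    push_cast
    ring
  have hN : ((‖Complex.Gamma ((-1 + Complex.I * t) / 4)‖ ^ 2 : ℝ) : ℂ) =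
      Complex.Gamma ((s - 1) / 2) * Complex.Gamma (-s / 2) := by
    have hc : -s / 2 = (starRingEnd ℂ) ((s - 1) / 2) := by
      rw [hs, map_div₀, map_sub, map_add, map_mul, Complex.conj_ofReal, Complex.conj_I, map_div₀,
        map_one, map_ofNat]
      ring
    rw [hA, hc, Complex.Gamma_conj, Complex.mul_conj, Complex.normSq_eq_norm_sq]
  have g1 : Complex.Gamma (s / 2 + 1 / 2) = (s - 1) / 2 * Complex.Gamma ((s - 1) / 2) := by
    rw [← Complex.Gamma_add_one _ (div_ne_zero hs1 two_ne_zero)]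
    congr 1
    ring
  have g2 : Complex.Gamma ((1 - s) / 2 + 1 / 2) = -s / 2 * Complex.Gamma (-s / 2) := by
    rw [← Complex.Gamma_add_one _ (div_ne_zero (neg_ne_zero.2 hs0) two_ne_zero)]
    congr 1
    ring
  have d1 := Complex.Gamma_mul_Gamma_add_half (s / 2)
  have d2 := Complex.Gamma_mul_Gamma_add_half ((1 - s) / 2)
  rw [g1, mul_div_cancel₀ _ (two_ne_zero' ℂ)] at d1
  rw [g2, mul_div_cancel₀ _ (two_ne_zero' ℂ)] at d2
  have p2 : (2 : ℂ) ^ (1 - s) * (2 : ℂ) ^ (1 - (1 - s)) = 2 := by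
    rw [← Complex.cpow_add _ _ two_ne_zero]
    ring_nf
    simp
  have pq : (π : ℂ) ^ (-s / 2) * (π : ℂ) ^ (-(1 - s) / 2) * ((√π : ℝ) : ℂ) = 1 := by
    have hpi : (π : ℂ) ≠ 0 := by exact_mod_cast pi_ne_zero
    rw [sqrt_eq_rpow, Complex.ofReal_cpow pi_pos.le, ← Complex.cpow_add _ _ hpi,
      ← Complex.cpow_add _ _ hpi]
    push_cast
    ring_nf
    simp
  have ht : (1 + (t : ℂ) ^ 2) = 4 * (s * (1 - s)) := by
    rw [hs]
    push_cast
    linear_combination (t : ℂ) ^ 2 * Complex.I_sq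
  rw [hN, hX2, Complex.Gammaℝ_def, Complex.Gammaℝ_def]
  push_cast
  rw [critWeight_eq hs, ht]
  have d12 := congrArg₂ (· * ·) d1 d2
  linear_combination
    (-(s * (s - 1)) * (π : ℂ) ^ (-s / 2) * (π : ℂ) ^ (-(1 - s) / 2) * riemannZeta s *
      riemannZeta (1 - s)) * d12 +
    (-(s * (s - 1)) * (π : ℂ) ^ (-s / 2) * (π : ℂ) ^ (-(1 - s) / 2) * riemannZeta s *
      riemannZeta (1 - s) * Complex.Gamma s * Complex.Gamma (1 - s) * ((√π : ℝ) : ℂ) ^ 2) * p2 +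
    (-(2 * (s * (s - 1))) * riemannZeta s * riemannZeta (1 - s) * Complex.Gamma s *
      Complex.Gamma (1 - s) * ((√π : ℝ) : ℂ)) * pq

end KoshliakovModular

end

theorem corollary4p10 (α β : ℝ) (hα : 0 < α) (hβ : 0 < β) (hαβ : α * β = 1) :
    Summable (fun n : ℕ => KoshliakovModular.tau (((n : ℝ) + 1) * α)) ∧
    Summable (fun n : ℕ => KoshliakovModular.tau (((n : ℝ) + 1) * β)) ∧
    IntegrableOn (KoshliakovModular.modularIntegrand α) (Ioi 0) ∧
    KoshliakovModular.modularSide α = KoshliakovModular.modularSide β ∧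
    ((KoshliakovModular.modularSide β : ℝ) : ℂ) =
      ((-(2 / Real.pi ^ (3 / 2 : ℝ)) : ℝ) : ℂ) *
        ∫ t in Ioi (0 : ℝ), KoshliakovModular.modularIntegrand α t := by
  have hlog : Real.log β = -Real.log α := by
    have := Real.log_mul hα.ne' hβ.ne'
    rw [hαβ, Real.log_one] at this
    linarith
  have hside : KoshliakovModular.modularSide α = KoshliakovModular.modularSide β := by
    rw [KoshliakovModular.modularSide_eq_integral hα, KoshliakovModular.modularSide_eq_integral hβ,
      hlog]
    simp only [mul_neg, Real.cos_neg]
  have hfun : KoshliakovModular.modularIntegrand α = fun t : ℝ =>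
      ((√Real.pi / 2 * (Real.cos (1 / 2 * t * Real.log α) *
        (√2 * Real.cos (1 / 2 * t * Real.log 2) - 1) *
          KoshliakovModular.critWeight t) : ℝ) : ℂ) := by
    funext t
    have ht : 1 + t ^ 2 ≠ 0 := by positivity
    rw [KoshliakovModular.modularIntegrand, KoshliakovModular.norm_Gamma_sq_mul_Xi_sq,
      ← Complex.ofReal_mul]
    congr 1
    field_simp
  have hint := (KoshliakovModular.integrable_cos_mul_sub_one_mul_critWeight α).const_mul
    (√Real.pi / 2)
  refine ⟨KoshliakovModular.summable_tau hα, KoshliakovModular.summable_tau hβ, ?_, hside, ?_⟩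
  · rw [hfun]
    exact hint.ofReal.integrableOn
  · rw [hfun, integral_complex_ofReal, ← hside, KoshliakovModular.modularSide_eq_integral hα,
      integral_const_mul, ← Complex.ofReal_mul]
    congr 1
    -- The constants match because (2/π^{3/2})(√π/2) = 1/π.
    have h : Real.pi ^ (3 / 2 : ℝ) = Real.pi * √Real.pi := by
      rw [Real.sqrt_eq_rpow, show (3 / 2 : ℝ) = 1 + 1 / 2 by norm_num,
        Real.rpow_add Real.pi_pos, Real.rpow_one]
    have h1 := Real.pi_pos
    have h2 := Real.sqrt_pos.2 Real.pi_pos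
    rw [h]
    generalize ∫ t in Ioi 0, Real.cos (1 / 2 * t * Real.log α) *
      (√2 * Real.cos (1 / 2 * t * Real.log 2) - 1) * KoshliakovModular.critWeight t = J
    field_simp
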